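/- \textbf{Setting.} An ultragraph $\mathcal G=(G^0,\mathcal G^1,r,s)$ consists of countable sets $G^0$ (vertices) and $\mathcal G^1$ (edges), a source map $s:\mathcal G^1\to G^0$ and a range map $r:\mathcal G^1\to P(G^0)\setminus\{\emptyset\}$. Let $\mathcal G^0\subseteq P(G^0)$ be the smallest family that contains $\emptyset$, all singletons $\{v\}$ and all $r(e)$, and is closed under finite unions and under intersections of two members. The algebra $C^*(\mathcal G)$ is the universal C*-algebra generated by partial isometries $\{s_e\}_{e\in\mathcal G^1}$ with mutually orthogonal ranges and projections $\{p_A\}_{A\in\mathcal G^0}$ such that $p_\emptyset=0$, $p_Ap_B=p_{A\cap B}$, $p_{A\cup B}=p_A+p_B-p_{A\cap B}$, $s_e^*s_e=p_{r(e)}$, $s_es_e^*\le p_{s(e)}$, and $p_v=\sum_{s(e)=v}s_es_e^*$ whenever $0<|s^{-1}(v)|<\infty$ (with $p_v:=p_{\{v\}}$). Let $\pi:C^*(\mathcal G)\to B(H)$ be a representation (a $*$-homomorphism, not assumed nondegenerate) on a complex Hilbert space $H$. Put $H_A:=\pi(p_A)(H)$, $H_v:=H_{\{v\}}$ and $H_e:=\pi(s_es_e^*)(H)$.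 The representation $\pi$ is \emph{permutative} if there are orthonormal bases $B$ of $H$, $B_v$ of $H_v$ for each $v\in G^0$, and $B_{r(e)}$ of $H_{r(e)}$ and $B_e$ of $H_e$ for each $e\in\mathcal G^1$, such that (1) $B_{r(e)}\subseteq B$ and $B_v\subseteq B$ for all $e$ and $v$; (2) $B_v\subseteq B_{r(e)}$ whenever $v\in r(e)$; (3) $\bigcup_{e\in s^{-1}(v)}B_e\subseteq B_v$ for all $v$; (4) $\pi(s_e)(B_{r(e)})=B_e$ for all $e$. In an ultragraph with edge set $F$, a set $A$ of vertices is an \emph{extreme vertex}, with \emph{extreme edge} $e\in F$, if either $A=r(e)$, $A\cap\bigcup_{f\in F\setminus\{e\}}r(f)=\emptyset$ and $A\cap s(F)=\emptyset$, or $A=\{s(e)\}$, $A\cap s(F\setminus\{e\})=\emptyset$ and $A\cap\bigcup_{f\in F}r(f)=\emptyset$. A vertex is \emph{isolated} if it is neither the source of an edge in $F$ nor an element of the range of one. Let $\mathbb G_0$ be $\mathcal G$ with its isolated vertices removed. Given $\mathbb G_i$ $(i\ge 0)$, let $X_{i+1}$ be the set of its extreme vertices, $Y_{i+1}$ the set of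 its extreme edges, and $\overline{X_{i+1}}=\bigcup_{A\in X_{i+1}}A$. Remove the vertices in $\overline{X_{i+1}}$ and the edges in $Y_{i+1}$ from $\mathbb G_i$, let $I_{i+1}$ be the set of isolated vertices of the ultragraph that remains, and let $\mathbb G_{i+1}$ be that ultragraph with $I_{i+1}$ removed. \textbf{Theorem.} Let $\mathcal G$ be an ultragraph and let $\pi:C^*(\mathcal G)\to B(H)$ be a representation such that, for every $e\in\mathcal G^1$, $H_{r(e)}=\bigoplus_{v\in r(e)}H_v$ (orthogonal Hilbert space direct sum). Suppose that there is $n\ge 1$ such that $X_1,\dots,X_n\neq\emptyset$ and $$\Big(\bigcup_{e\in\mathcal G^1}r(e)\Big)\cup s(\mathcal G^1)=\bigcup_{i=1}^n\big(\overline{X_i}\cup I_i\big).$$ Then $\pi$ is permutative. -/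

import Mathlib

open scoped ENNReal

universe u v w

/-- An ultragraph with vertex set `V` and edge set `E`: every edge has a source vertex and a
nonempty set of vertices as its range. (Countability of `V` and `E` is not part of this structure.) -/
structure Ultragraph (V : Type u) (E : Type v) where
  s : E → V
  r : E → Set V
  r_nonempty : ∀ e, (r e).Nonempty

namespace Ultragraph

variable {V : Type u} {E : Type v} (G : Ultragraph V E)

/-! ### Generalized vertices -/

/-- The smallest family of subsets of `V` containing all singletons and all ranges of edges, and
closed under finite unions (the empty one included) and intersections of two members. -/
inductive IsGenVertex : Set V → Prop
  | empty : IsGenVertex ∅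
  | singleton (v : V) : IsGenVertex {v}
  | range (e : E) : IsGenVertex (G.r e)
  | union {A B : Set V} : IsGenVertex A → IsGenVertex B → IsGenVertex (A ∪ B)
  | inter {A B : Set V} : IsGenVertex A → IsGenVertex B → IsGenVertex (A ∩ B)

/-- The generalized vertices of the ultragraph. -/
abbrev GenVertex : Type u := {A : Set V // G.IsGenVertex A}

/-- The generalized vertex `{v}`. -/
def vtx (v : V) : G.GenVertex := ⟨{v}, .singleton v⟩

/-- The generalized vertex `r e`. -/
def rng (e : E) : G.GenVertex := ⟨G.r e, .range e⟩

/-! ### Cuntz-Krieger families and the ultragraph C*-algebra -/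

/-- A Cuntz-Krieger family of the ultragraph in a `*`-ring: partial isometries `S e` with mutually
orthogonal ranges and projections `P A` subject to the Cuntz-Krieger relations. For the two
projections `S e (S e)*` and `P {s e}`, the relation `≤` is written as
`P {s e} * (S e (S e)*) = S e (S e)*`. -/
structure CKFamily (B : Type w) [NonUnitalRing B] [StarRing B] where
  S : E → B
  P : G.GenVertex → B
  isStarProjection : ∀ A, IsStarProjection (P A)
  partialIsometry : ∀ e, S e * star (S e) * S e = S e
  orthogonal : ∀ e f, e ≠ f → (S e * star (S e)) * (S f * star (S f)) = 0
  P_empty : P ⟨∅, .empty⟩ = 0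
  P_inter : ∀ A B, P A * P B = P ⟨A.1 ∩ B.1, .inter A.2 B.2⟩
  P_union : ∀ A B, P ⟨A.1 ∪ B.1, .union A.2 B.2⟩ = P A + P B - P ⟨A.1 ∩ B.1, .inter A.2 B.2⟩
  star_mul : ∀ e, star (S e) * S e = P (G.rng e)
  range_le : ∀ e, P (G.vtx (G.s e)) * (S e * star (S e)) = S e * star (S e)
  cuntzKrieger : ∀ v (h : {e | G.s e = v}.Finite), {e | G.s e = v}.Nonempty →
    P (G.vtx v) = ∑ e ∈ h.toFinset, S e * star (S e)

/-- A C*-algebra (in a fixed universe) together with a Cuntz-Krieger family in it. -/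
structure CKModel where
  carrier : Type (max u v)
  [inst : NonUnitalCStarAlgebra carrier]
  family : G.CKFamily carrier

attribute [instance] CKModel.inst

section Universal

variable {G}

theorem CKFamily.norm_S_le {B : Type w} [NonUnitalCStarAlgebra B] (F : G.CKFamily B) (e : E) :
    ‖F.S e‖ ≤ 1 := by
  have h1 : ‖F.S e‖ * ‖F.S e‖ ≤ 1 := by
    rw [← CStarRing.norm_star_mul_self, F.star_mul]
    exact IsStarProjection.norm_le _ (F.isStarProjection _)
  nlinarith [norm_nonneg (F.S e)]

theorem CKFamily.norm_P_le {B : Type w} [NonUnitalCStarAlgebra B] (F : G.CKFamily B)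
    (A : G.GenVertex) : ‖F.P A‖ ≤ 1 :=
  IsStarProjection.norm_le _ (F.isStarProjection _)

variable (G)

/-- The bounded elements of the product of all C*-algebras carrying a Cuntz-Krieger family. -/
abbrev BigProduct : Type (max u v + 1) := lp (fun i : G.CKModel => i.carrier) ∞

/-- The family `(S_e^i)_i` in the product of all Cuntz-Krieger models. -/
noncomputable def bigS (e : E) : G.BigProduct :=
  ⟨fun i => i.family.S e, memℓp_infty ⟨1, by rintro _ ⟨i, rfl⟩; exact i.family.norm_S_le e⟩⟩

/-- The family `(P_A^i)_i` in the product of all Cuntz-Krieger models. -/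
noncomputable def bigP (A : G.GenVertex) : G.BigProduct :=
  ⟨fun i => i.family.P A, memℓp_infty ⟨1, by rintro _ ⟨i, rfl⟩; exact i.family.norm_P_le A⟩⟩

/-- The elements `(S_e^i)_i` and `(P_A^i)_i` form a Cuntz-Krieger family. -/
noncomputable def bigFamily : G.CKFamily G.BigProduct where
  S := G.bigS
  P := G.bigP
  isStarProjection A :=
    ⟨lp.ext (funext fun i => (i.family.isStarProjection A).isIdempotentElem),
      lp.ext (funext fun i => (i.family.isStarProjection A).isSelfAdjoint)⟩
  partialIsometry e := lp.ext (funext fun i => i.family.partialIsometry e)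
  orthogonal e f h := lp.ext (funext fun i => i.family.orthogonal e f h)
  P_empty := lp.ext (funext fun i => i.family.P_empty)
  P_inter A B := lp.ext (funext fun i => i.family.P_inter A B)
  P_union A B := lp.ext (funext fun i => i.family.P_union A B)
  star_mul e := lp.ext (funext fun i => i.family.star_mul e)
  range_le e := lp.ext (funext fun i => i.family.range_le e)
  cuntzKrieger v h hne := lp.ext (funext fun i => by
    rw [lp.coeFn_sum, Finset.sum_apply]
    exact i.family.cuntzKrieger v h hne)

/-- A Cuntz-Krieger family all of whose members lift along an injective `*`-homomorphism. -/
def CKFamily.ofInjective {G : Ultragraph V E} {D : Type*} {B : Type*} [NonUnitalCStarAlgebra D]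
    [NonUnitalCStarAlgebra B] (F : G.CKFamily B) (ψ : D →⋆ₙₐ[ℂ] B) (hψ : Function.Injective ψ)
    (S : E → D) (P : G.GenVertex → D) (hS : ∀ e, ψ (S e) = F.S e) (hP : ∀ A, ψ (P A) = F.P A) :
    G.CKFamily D where
  S := S
  P := P
  isStarProjection A :=
    ⟨hψ (by simpa [hP] using (F.isStarProjection A).isIdempotentElem.eq),
      hψ (by simpa [hP, map_star] using (F.isStarProjection A).isSelfAdjoint.star_eq)⟩
  partialIsometry e := hψ (by simpa [hS, map_star] using F.partialIsometry e)
  orthogonal e f h := hψ (by simpa [hS, map_star] using F.orthogonal e f h)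
  P_empty := hψ (by simpa [hP] using F.P_empty)
  P_inter A B := hψ (by simpa [hP] using F.P_inter A B)
  P_union A B := hψ (by simpa [hP] using F.P_union A B)
  star_mul e := hψ (by simpa [hS, hP, map_star] using F.star_mul e)
  range_le e := hψ (by simpa [hS, hP, map_star] using F.range_le e)
  cuntzKrieger v h hne := hψ (by simpa [hS, hP, map_star] using F.cuntzKrieger v h hne)

/-- The C*-subalgebra generated by the members of a Cuntz-Krieger family. -/
noncomputable def CKFamily.generated {G : Ultragraph V E} {B : Type*} [NonUnitalCStarAlgebra B]
    (F : G.CKFamily B) : NonUnitalStarSubalgebra ℂ B :=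
  (NonUnitalStarAlgebra.adjoin ℂ (Set.range F.S ∪ Set.range F.P)).topologicalClosure

/-- The ultragraph C*-algebra `C*(G)`: the C*-algebra generated by the direct product of all
Cuntz-Krieger families. By `existsUnique_lift` below it has the universal property of the
C*-algebra generated by a Cuntz-Krieger family. -/
def CStar : Type (max u v + 1) := ↥G.bigFamily.generated

noncomputable instance : NonUnitalCStarAlgebra G.CStar :=
  NonUnitalStarSubalgebra.nonUnitalCStarAlgebra G.bigFamily.generated
    (h_closed := NonUnitalStarSubalgebra.isClosed_topologicalClosure _)

/-- The inclusion of `C*(G)` in the product of all models. -/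
noncomputable def CStar.incl : G.CStar →⋆ₙₐ[ℂ] G.BigProduct :=
  NonUnitalStarSubalgebraClass.subtype G.bigFamily.generated

theorem CKFamily.S_mem_generated {G : Ultragraph V E} {B : Type*} [NonUnitalCStarAlgebra B]
    (F : G.CKFamily B) (e : E) : F.S e ∈ F.generated :=
  NonUnitalStarSubalgebra.le_topologicalClosure _
    (NonUnitalStarAlgebra.subset_adjoin ℂ _ (Or.inl ⟨e, rfl⟩))

theorem CKFamily.P_mem_generated {G : Ultragraph V E} {B : Type*} [NonUnitalCStarAlgebra B]
    (F : G.CKFamily B) (A : G.GenVertex) : F.P A ∈ F.generated :=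
  NonUnitalStarSubalgebra.le_topologicalClosure _
    (NonUnitalStarAlgebra.subset_adjoin ℂ _ (Or.inr ⟨A, rfl⟩))

/-- The universal Cuntz-Krieger family `{s_e, p_A}` generating `C*(G)`. -/
noncomputable def univFamily : G.CKFamily G.CStar :=
  G.bigFamily.ofInjective (CStar.incl G) Subtype.val_injective
    (fun e => ⟨G.bigS e, G.bigFamily.S_mem_generated e⟩)
    (fun A => ⟨G.bigP A, G.bigFamily.P_mem_generated A⟩) (fun _ => rfl) (fun _ => rfl)


/-! ### The universal property of `C*(G)` -/

/-- A small C*-algebra is isomorphic to one in the given universe. -/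
theorem exists_shrink (D : Type w) [NonUnitalCStarAlgebra D] [Small.{max u v} D] :
    ∃ (D' : Type (max u v)) (_ : NonUnitalCStarAlgebra D') (ψ : D' →⋆ₙₐ[ℂ] D),
      Function.Bijective ψ := by
  obtain ⟨D', ⟨e⟩⟩ : ∃ D' : Type (max u v), Nonempty (D' ≃ D) :=
    ⟨Shrink.{max u v} D, ⟨(equivShrink D).symm⟩⟩
  let r0 : NonUnitalRing D' := e.nonUnitalRing
  have hadd : ∀ x y : D', e (x + y) = e x + e y := fun x y => e.apply_symm_apply _
  have hmul : ∀ x y : D', e (x * y) = e x * e y := fun x y => e.apply_symm_apply _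
  let m0 : Module ℂ D' := e.module ℂ
  have hsmul : ∀ (c : ℂ) (x : D'), e (c • x) = c • e x := fun c x => e.apply_symm_apply _
  have hzero : e 0 = 0 := e.apply_symm_apply _
  let φ : D' →ₙ+* D :=
    { toFun := e, map_add' := hadd, map_mul' := hmul, map_zero' := hzero }
  let nr : NonUnitalNormedRing D' := NonUnitalNormedRing.induced D' D φ e.injective
  have hnorm : ∀ x : D', ‖x‖ = ‖e x‖ := fun _ => rfl
  have hiso : Isometry e := AddMonoidHomClass.isometry_of_norm φ (fun _ => rfl)
  let st : Star D' := ⟨fun x => e.symm (star (e x))⟩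
  have hstar : ∀ x : D', e (star x) = star (e x) := fun x => e.apply_symm_apply _
  let sr : StarRing D' :=
    { star_involutive := fun x => e.injective (by simp [hstar])
      star_mul := fun x y => e.injective (by simp [hstar, hmul])
      star_add := fun x y => e.injective (by simp [hstar, hadd]) }
  let ns : NormedSpace ℂ D' :=
    { m0 with norm_smul_le := fun c x => by rw [hnorm, hnorm, hsmul]; exact norm_smul_le _ _ }
  have hcomplete : CompleteSpace D' :=
    (completeSpace_congr (e := e) hiso.isUniformEmbedding).2 inferInstance
  let cs : NonUnitalCStarAlgebra D' :=
    { nr, sr, ns, hcomplete with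
      norm_mul_self_le := fun x => by
        rw [hnorm, hnorm, hmul, hstar]; exact CStarRing.norm_mul_self_le _
      smul_assoc := fun c x y => e.injective (by simp [hsmul, hmul, smul_mul_assoc])
      smul_comm := fun c x y => e.injective (by simp [hsmul, hmul, mul_smul_comm])
      star_smul := fun c x => e.injective (by simp [hsmul, hstar]) }
  exact ⟨D', cs,
    { toFun := e, map_smul' := hsmul, map_zero' := hzero, map_add' := hadd, map_mul' := hmul,
      map_star' := hstar }, e.bijective⟩

/-- Formal `*`-polynomials in a set of generators. -/
inductive Term (X : Type u) : Type u
  | zero : Term X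
  | gen (x : X) : Term X
  | add (a b : Term X) : Term X
  | mul (a b : Term X) : Term X
  | smul (c : ℂ) (a : Term X) : Term X
  | star (a : Term X) : Term X

/-- Evaluation of a formal `*`-polynomial. -/
def Term.eval {X : Type*} {B : Type*} [NonUnitalCStarAlgebra B] (f : X → B) : Term X → B
  | .zero => 0
  | .gen x => f x
  | .add a b => a.eval f + b.eval f
  | .mul a b => a.eval f * b.eval f
  | .smul c a => c • a.eval f
  | .star a => Star.star (a.eval f)

theorem CKFamily.small_generated {G : Ultragraph V E} {B : Type w} [NonUnitalCStarAlgebra B]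
    (F : G.CKFamily B) : Small.{max u v} F.generated := by
  let f : E ⊕ G.GenVertex → B := Sum.elim F.S F.P
  have hadj : ∀ x ∈ NonUnitalStarAlgebra.adjoin ℂ (Set.range F.S ∪ Set.range F.P),
      ∃ t : Term (E ⊕ G.GenVertex), t.eval f = x := by
    intro x hx
    induction hx using NonUnitalStarAlgebra.adjoin_induction with
    | mem x hx =>
      rcases hx with ⟨e, rfl⟩ | ⟨A, rfl⟩
      · exact ⟨.gen (.inl e), rfl⟩
      · exact ⟨.gen (.inr A), rfl⟩
    | add x y _ _ hx hy =>
      obtain ⟨a, rfl⟩ := hx; obtain ⟨b, rfl⟩ := hy; exact ⟨.add a b, rfl⟩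
    | zero => exact ⟨.zero, rfl⟩
    | mul x y _ _ hx hy =>
      obtain ⟨a, rfl⟩ := hx; obtain ⟨b, rfl⟩ := hy; exact ⟨.mul a b, rfl⟩
    | smul c x _ hx => obtain ⟨a, rfl⟩ := hx; exact ⟨.smul c a, rfl⟩
    | star x _ hx => obtain ⟨a, rfl⟩ := hx; exact ⟨.star a, rfl⟩
  have hcl : ∀ x : F.generated, ∃ t : ℕ → Term (E ⊕ G.GenVertex),
      Filter.Tendsto (fun n => (t n).eval f) Filter.atTop (nhds (x : B)) := by
    intro x
    obtain ⟨y, hy, hlim⟩ := mem_closure_iff_seq_limit.1 x.2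
    choose t ht using fun n => hadj (y n) (hy n)
    exact ⟨t, by simpa only [ht] using hlim⟩
  choose t ht using hcl
  refine small_of_injective (f := t) fun x y hxy => Subtype.ext ?_
  exact tendsto_nhds_unique (ht x) (by simpa only [hxy] using ht y)

/-- Projection of `C*(G)` onto one of the Cuntz-Krieger models. -/
noncomputable def CStar.proj (i : G.CKModel) : G.CStar →⋆ₙₐ[ℂ] i.carrier where
  toFun x := (CStar.incl G x : G.BigProduct) i
  map_smul' c x := by simp
  map_zero' := by simp
  map_add' x y := by simp
  map_mul' x y := by simp [lp.infty_coeFn_mul]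
  map_star' x := by simp [map_star]

/-- `C*(G)` is generated by the universal family. -/
theorem generated_univFamily : G.univFamily.generated = ⊤ := by
  have hind : Topology.IsInducing (CStar.incl G) := Topology.IsInducing.subtypeVal
  rw [eq_top_iff]
  intro x _
  change x ∈ closure ((NonUnitalStarAlgebra.adjoin ℂ
    (Set.range G.univFamily.S ∪ Set.range G.univFamily.P) : NonUnitalStarSubalgebra ℂ G.CStar) :
      Set G.CStar)
  rw [hind.closure_eq_preimage_closure_image, Set.mem_preimage,
    ← NonUnitalStarSubalgebra.coe_map, NonUnitalStarAlgHom.map_adjoin, Set.image_union,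
    ← Set.range_comp, ← Set.range_comp]
  exact x.2

/-- The universal property of `C*(G)`: every Cuntz-Krieger family in any C*-algebra is the image of
the universal one under exactly one `*`-homomorphism. -/
theorem existsUnique_lift {B : Type w} [NonUnitalCStarAlgebra B] (F : G.CKFamily B) :
    ∃! φ : G.CStar →⋆ₙₐ[ℂ] B,
      (∀ e, φ (G.univFamily.S e) = F.S e) ∧ ∀ A, φ (G.univFamily.P A) = F.P A := by
  have : Small.{max u v} F.generated := F.small_generated
  let : NonUnitalCStarAlgebra F.generated :=
    NonUnitalStarSubalgebra.nonUnitalCStarAlgebra F.generated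
      (h_closed := NonUnitalStarSubalgebra.isClosed_topologicalClosure _)
  obtain ⟨D', _, ψ, hψ⟩ := exists_shrink.{u, v, w} F.generated
  let ι : F.generated →⋆ₙₐ[ℂ] B := NonUnitalStarSubalgebraClass.subtype F.generated
  choose g hg using hψ.2
  have hS : ∀ e, (ι.comp ψ) (g ⟨F.S e, F.S_mem_generated e⟩) = F.S e := fun e => by
    change ι (ψ _) = _
    rw [hg]; rfl
  have hP : ∀ A, (ι.comp ψ) (g ⟨F.P A, F.P_mem_generated A⟩) = F.P A := fun A => by
    change ι (ψ _) = _
    rw [hg]; rfl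
  let i : G.CKModel := ⟨D', F.ofInjective (ι.comp ψ) (Subtype.val_injective.comp hψ.1) _ _ hS hP⟩
  refine ⟨(ι.comp ψ).comp (CStar.proj G i), ⟨hS, hP⟩, ?_⟩
  rintro φ ⟨h1, h2⟩
  let χ := (ι.comp ψ).comp (CStar.proj G i)
  have hφc : Continuous φ := AddMonoidHomClass.continuous_of_bound φ 1
    (by simpa only [one_mul] using NonUnitalStarAlgHom.norm_apply_le φ)
  have hχc : Continuous χ := AddMonoidHomClass.continuous_of_bound χ 1
    (by simpa only [one_mul] using NonUnitalStarAlgHom.norm_apply_le χ)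
  have hle : G.univFamily.generated ≤ NonUnitalStarAlgHom.equalizer φ χ := by
    refine NonUnitalStarSubalgebra.topologicalClosure_minimal _
      (NonUnitalStarAlgebra.adjoin_le ?_) (isClosed_eq hφc hχc)
    rintro _ (⟨e, rfl⟩ | ⟨A, rfl⟩)
    · exact (h1 e).trans (hS e).symm
    · exact (h2 A).trans (hP A).symm
  rw [generated_univFamily] at hle
  exact NonUnitalStarAlgHom.ext fun x => hle (x := x) trivial

end Universal

/-! ### Iterated removal of extreme vertices and isolated vertices -/

/-- A sub-ultragraph `(verts, edges, r, s)` of `G`. -/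
structure Sub where
  verts : Set V
  edges : Set E
  s_mem : ∀ e ∈ edges, G.s e ∈ verts
  r_subset : ∀ e ∈ edges, G.r e ⊆ verts

namespace Sub

variable {G} (K : G.Sub)

/-- `A` is an extreme vertex with extreme edge `e`, by being the range of `e` and disjoint from all
sources and from the ranges of all other edges. -/
def IsFinalExtreme (A : Set V) (e : E) : Prop :=
  e ∈ K.edges ∧ A = G.r e ∧ A ∩ (⋃ f ∈ K.edges \ {e}, G.r f) = ∅ ∧ A ∩ (G.s '' K.edges) = ∅

/-- `A` is an extreme vertex with extreme edge `e`, by being the source of `e` and disjoint from all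
ranges and from the sources of all other edges. -/
def IsInitialExtreme (A : Set V) (e : E) : Prop :=
  e ∈ K.edges ∧ A = {G.s e} ∧ A ∩ (G.s '' (K.edges \ {e})) = ∅ ∧ A ∩ (⋃ f ∈ K.edges, G.r f) = ∅

/-- The set of extreme vertices (each of them a set of vertices). -/
def extremeVertices : Set (Set V) :=
  {A | ∃ e, K.IsFinalExtreme A e ∨ K.IsInitialExtreme A e}

/-- The set of extreme edges. -/
def extremeEdges : Set E :=
  {e | ∃ A, K.IsFinalExtreme A e ∨ K.IsInitialExtreme A e}

/-- The set of isolated vertices. -/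
def isolated : Set V :=
  {x | x ∈ K.verts ∧ x ∉ (⋃ e ∈ K.edges, G.r e) ∪ G.s '' K.edges}

/-- Remove the isolated vertices. -/
def removeIsolated : G.Sub where
  verts := K.verts \ K.isolated
  edges := K.edges
  s_mem e he := ⟨K.s_mem e he, fun h => h.2 (Or.inr ⟨e, he, rfl⟩)⟩
  r_subset e he _ hx := ⟨K.r_subset e he hx, fun h => h.2 (Or.inl (Set.mem_biUnion he hx))⟩

/-- Remove the vertices lying in extreme vertices, and the extreme edges. -/
def removeExtreme : G.Sub where
  verts := K.verts \ ⋃₀ K.extremeVertices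
  edges := K.edges \ K.extremeEdges
  s_mem e he := by
    refine ⟨K.s_mem e he.1, ?_⟩
    rintro ⟨A, ⟨f, hf⟩, hA⟩
    have hne : e ≠ f := by rintro rfl; exact he.2 ⟨A, hf⟩
    rcases hf with hf | hf
    · exact Set.eq_empty_iff_forall_notMem.1 hf.2.2.2 _ ⟨hA, e, he.1, rfl⟩
    · exact Set.eq_empty_iff_forall_notMem.1 hf.2.2.1 _ ⟨hA, e, ⟨he.1, hne⟩, rfl⟩
  r_subset e he x hx := by
    refine ⟨K.r_subset e he.1 hx, ?_⟩
    rintro ⟨A, ⟨f, hf⟩, hA⟩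
    have hne : e ≠ f := by rintro rfl; exact he.2 ⟨A, hf⟩
    rcases hf with hf | hf
    · exact Set.eq_empty_iff_forall_notMem.1 hf.2.2.1 _
        ⟨hA, Set.mem_biUnion (show e ∈ K.edges \ {f} from ⟨he.1, hne⟩) hx⟩
    · exact Set.eq_empty_iff_forall_notMem.1 hf.2.2.2 _ ⟨hA, Set.mem_biUnion he.1 hx⟩

end Sub

/-- `G` as a sub-ultragraph of itself. -/
def top : G.Sub := ⟨Set.univ, Set.univ, fun _ _ => trivial, fun _ _ _ _ => trivial⟩

/-- The successive ultragraphs `𝔾₀, 𝔾₁, …`: first remove the isolated vertices of `G`; then, at each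
step, remove the extreme vertices and edges, and after that the isolated vertices thus created. -/
def stage : ℕ → G.Sub
  | 0 => G.top.removeIsolated
  | n + 1 => (stage n).removeExtreme.removeIsolated

/-- `X_{i+1}`, the set of extreme vertices of `𝔾_i`. -/
def X (i : ℕ) : Set (Set V) := (G.stage i).extremeVertices

/-- `I_{i+1}`, the set of vertices that are isolated after the removal of the extreme vertices and
extreme edges of `𝔾_i`. -/
def I (i : ℕ) : Set V := (G.stage i).removeExtreme.isolated

/-! ### Representations -/

section Representation

variable {G} {H : Type*} [NormedAddCommGroup H] [InnerProductSpace ℂ H] [CompleteSpace H]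
  (π : G.CStar →⋆ₙₐ[ℂ] (H →L[ℂ] H))

/-- The subspace `H_A = π(p_A)(H)`. -/
noncomputable def vertexSpace (A : G.GenVertex) : Submodule ℂ H :=
  (π (G.univFamily.P A)).range

/-- The subspace `H_e = π(s_e s_e*)(H)`. -/
noncomputable def edgeSpace (e : E) : Submodule ℂ H :=
  (π (G.univFamily.S e * star (G.univFamily.S e))).range

end Representation
end Ultragraph

section Hilbert

variable {H : Type*} [NormedAddCommGroup H] [InnerProductSpace ℂ H]

/-- `K` is the (Hilbert space) orthogonal direct sum of the subspaces `U i`. -/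
def IsOrthogonalSum {ι : Type*} (K : Submodule ℂ H) (U : ι → Submodule ℂ H) : Prop :=
  (Pairwise fun i j => U i ⟂ U j) ∧ (⨆ i, U i).topologicalClosure = K

/-- The set `B` is an orthonormal basis of the closed subspace `K`. -/
def IsONBasis (B : Set H) (K : Submodule ℂ H) : Prop :=
  Orthonormal ℂ (Subtype.val : B → H) ∧ (Submodule.span ℂ B).topologicalClosure = K

end Hilbert

/-- A permutative representation of `C*(G)`. -/
def Ultragraph.IsPermutative {V : Type u} {E : Type v} {G : Ultragraph V E} {H : Type*}
    [NormedAddCommGroup H] [InnerProductSpace ℂ H] [CompleteSpace H]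
    (π : G.CStar →⋆ₙₐ[ℂ] (H →L[ℂ] H)) : Prop :=
  ∃ (B : Set H) (Bv : V → Set H) (Br Be : E → Set H),
    IsONBasis B ⊤ ∧
    (∀ x, IsONBasis (Bv x) (Ultragraph.vertexSpace π (G.vtx x))) ∧
    (∀ e, IsONBasis (Br e) (Ultragraph.vertexSpace π (G.rng e))) ∧
    (∀ e, IsONBasis (Be e) (Ultragraph.edgeSpace π e)) ∧
    ((∀ e, Br e ⊆ B) ∧ ∀ x, Bv x ⊆ B) ∧
    (∀ x e, x ∈ G.r e → Bv x ⊆ Br e) ∧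
    (∀ x, (⋃ e ∈ {e | G.s e = x}, Be e) ⊆ Bv x) ∧
    (∀ e, π (G.univFamily.S e) '' Br e = Be e)

/-! The bases are built backwards along edges. If `Bv w` is known for every `w ∈ r(e)`, the
decomposition of `H_{r(e)}` makes the union of these sets an orthonormal basis of `H_{r(e)}`. Since
`s_e` maps `H_{r(e)}` isometrically onto `H_e`, condition (4) then dictates the basis of `H_e`. The
spaces `H_e` with `s(e) = v` are mutually orthogonal subspaces of `H_v`, so their bases together
extend to a basis `Bv v` (`exists_compatible_bases`). Condition (3) asks only for an inclusion, so
the added vectors are arbitrary.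

This recursion is legitimate when there is no infinite path (a cycle counts as one), and that is
what the removal process provides (`wellFounded_isSucc`). An edge preceded and followed by surviving
edges is not extreme, so an infinite path loses at most its first remaining edge at each step, and
its tail survives every finite number of steps. Exhaustion of all sources and ranges after `n` steps
excludes this. -/

/-! ### Orthonormal bases of closed subspaces. -/

section HilbertLemmas

variable {H : Type*} [NormedAddCommGroup H] [InnerProductSpace ℂ H]

theorem IsONBasis.subset {B : Set H} {K : Submodule ℂ H} (h : IsONBasis B K) : B ⊆ K := by
  rw [← h.2]
  exact Submodule.subset_span.trans (Submodule.le_topologicalClosure _)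

/-- An orthonormal subset of a complete subspace extends to an orthonormal basis of it. -/
theorem exists_isONBasis_extension {K : Submodule ℂ H} [CompleteSpace K] {S : Set H}
    (hS : Orthonormal ℂ (Subtype.val : S → H)) (hSK : S ⊆ K) :
    ∃ B, S ⊆ B ∧ IsONBasis B K := by
  classical
  -- Maximality is taken among orthonormal sets in the Hilbert space `K` itself, so that the
  -- extension does not leave `K`.
  have hS' : Orthonormal ℂ (Subtype.val : (Subtype.val ⁻¹' S : Set K) → K) := by
    rw [orthonormal_subtype_iff_ite] at hS ⊢
    intro x hx y hy
    simpa only [Submodule.coe_inner, Subtype.ext_iff] using hS x hx y hy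
  obtain ⟨u, hSu, hu, hd⟩ := exists_maximal_orthonormal hS'
  have hdense := (maximal_orthonormal_iff_orthogonalComplement_eq_bot hu).1 hd
  rw [← Submodule.topologicalClosure_eq_top_iff] at hdense
  refine ⟨Subtype.val '' u, fun x hx => ⟨⟨x, hSK hx⟩, hSu hx, rfl⟩, ?_, ?_⟩
  · rw [orthonormal_subtype_iff_ite] at hu ⊢
    rintro _ ⟨x, hx, rfl⟩ _ ⟨y, hy, rfl⟩
    simpa only [Submodule.coe_inner, Subtype.ext_iff] using hu x hx y hy
  · have hspan : Submodule.span ℂ (Subtype.val '' u) = (Submodule.span ℂ u).map K.subtype := by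
      rw [Submodule.map_span]; rfl
    rw [hspan]
    apply le_antisymm
    · refine Submodule.topologicalClosure_minimal _ (Submodule.map_subtype_le _ _) ?_
      exact (completeSpace_coe_iff_isComplete.1 ‹CompleteSpace K›).isClosed
    · intro x hx
      have h1 : (⟨x, hx⟩ : K) ∈ (Submodule.span ℂ u).topologicalClosure := by simp [hdense]
      exact map_mem_closure continuous_subtype_val h1 fun y hy => ⟨y, hy, rfl⟩

/-- A union of orthonormal subsets of mutually orthogonal subspaces is orthonormal. -/
theorem orthonormal_iUnion {ι : Type*} {B : ι → Set H} {U : ι → Submodule ℂ H}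
    (hB : ∀ i, Orthonormal ℂ (Subtype.val : B i → H)) (hBU : ∀ i, B i ⊆ U i)
    (hU : Pairwise fun i j => U i ⟂ U j) :
    Orthonormal ℂ (Subtype.val : (⋃ i, B i : Set H) → H) := by
  classical
  simp only [orthonormal_subtype_iff_ite] at hB ⊢
  intro x hx y hy
  obtain ⟨i, hi⟩ := Set.mem_iUnion.1 hx
  obtain ⟨j, hj⟩ := Set.mem_iUnion.1 hy
  by_cases hij : i = j
  · subst hij
    exact hB i x hi y hj
  · have h0 : inner ℂ x y = 0 :=
      Submodule.isOrtho_iff_inner_eq.1 (hU hij) x (hBU i hi) y (hBU j hj)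
    rw [h0, if_neg]
    -- A vector common to two orthogonal subspaces would have inner product `0` with itself, not
    -- `1`.
    rintro rfl
    have h1 := hB i x hi x hi
    rw [h0] at h1
    simp at h1

/-- This turns the decomposition of `H_{r(e)}` into a basis containing every `B_v` with `v ∈ r(e)`,
as condition (2) demands. -/
theorem IsOrthogonalSum.isONBasis_iUnion {ι : Type*} {K : Submodule ℂ H} {U : ι → Submodule ℂ H}
    (hK : IsOrthogonalSum K U) {B : ι → Set H} (hB : ∀ i, IsONBasis (B i) (U i)) :
    IsONBasis (⋃ i, B i) K := by
  refine ⟨orthonormal_iUnion (fun i => (hB i).1) (fun i => (hB i).subset) hK.1, ?_⟩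
  rw [← hK.2, Submodule.span_iUnion]
  apply le_antisymm
  · exact Submodule.topologicalClosure_mono
      (iSup_mono fun i => Submodule.span_le.2 (hB i).subset)
  · refine Submodule.topologicalClosure_minimal _ (iSup_le fun i => ?_)
      (Submodule.isClosed_topologicalClosure _)
    rw [← (hB i).2]
    exact Submodule.topologicalClosure_mono (le_iSup (fun i => Submodule.span ℂ (B i)) i)

/-- A map preserving inner products on `K` carries orthonormal bases of `K` to orthonormal bases of
the image of `K`, provided this image is closed. -/
theorem IsONBasis.image {B : Set H} {K L : Submodule ℂ H} (hB : IsONBasis B K) (T : H →L[ℂ] H)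
    (hT : ∀ x ∈ K, ∀ y ∈ K, inner ℂ (T x) (T y) = inner ℂ x y)
    (hL : K.map (T : H →ₗ[ℂ] H) = L) (hclosed : IsClosed (L : Set H)) :
    IsONBasis (T '' B) L := by
  classical
  constructor
  · have h := hB.1
    rw [orthonormal_subtype_iff_ite] at h ⊢
    rintro _ ⟨x, hx, rfl⟩ _ ⟨y, hy, rfl⟩
    rw [hT x (hB.subset hx) y (hB.subset hy), h x hx y hy]
    congr 1
    refine propext ⟨congrArg T, fun hxy => ?_⟩
    -- If `T x = T y` with `x ≠ y` in `B`, then `1 = ⟨y, y⟩ = ⟨T x, T y⟩ = ⟨x, y⟩ = 0`.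
    by_contra hne
    have h1 := hT x (hB.subset hx) y (hB.subset hy)
    rw [hxy, hT y (hB.subset hy) y (hB.subset hy), h y hy y hy, h x hx y hy] at h1
    simp [hne] at h1
  · have hspan : Submodule.span ℂ (T '' B) = (Submodule.span ℂ B).map (T : H →ₗ[ℂ] H) := by
      rw [Submodule.map_span]; rfl
    rw [hspan]
    apply le_antisymm
    · refine Submodule.topologicalClosure_minimal _ ?_ hclosed
      rw [← hL]
      exact Submodule.map_mono (Submodule.span_le.2 hB.subset)
    · rw [← hL, Submodule.map_le_iff_le_comap]
      intro x hx
      rw [← hB.2] at hx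
      exact map_mem_closure T.continuous hx fun y hy => ⟨y, hy, rfl⟩

open Classical in
/-- An orthonormal basis of `K` that contains `S`, if there is one. -/
noncomputable def extendBasis (K : Submodule ℂ H) (S : Set H) : Set H :=
  if h : ∃ B, S ⊆ B ∧ IsONBasis B K then h.choose else ∅

theorem extendBasis_spec {K : Submodule ℂ H} {S : Set H} (h : ∃ B, S ⊆ B ∧ IsONBasis B K) :
    S ⊆ extendBasis K S ∧ IsONBasis (extendBasis K S) K := by
  rw [extendBasis, dif_pos h]
  exact h.choose_spec

end HilbertLemmas

/-! ### Ranges of projections. -/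

theorem IsStarProjection.isClosed_range {H : Type*} [NormedAddCommGroup H]
    [InnerProductSpace ℂ H] [CompleteSpace H] {p : H →L[ℂ] H} (hp : IsStarProjection p) :
    IsClosed (p.range : Set H) := by
  have h : (p.range : Set H) = {x | p x = x} := by
    ext x
    constructor
    · rintro ⟨y, rfl⟩
      exact congrArg (fun q : H →L[ℂ] H => q y) hp.isIdempotentElem.eq
    · exact fun hx => ⟨x, hx⟩
  rw [h]
  exact isClosed_eq p.continuous continuous_id

theorem IsStarProjection.apply_of_mem_range {H : Type*} [NormedAddCommGroup H]
    [InnerProductSpace ℂ H] [CompleteSpace H] {p : H →L[ℂ] H} (hp : IsStarProjection p) {x : H}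
    (hx : x ∈ p.range) : p x = x := by
  obtain ⟨y, rfl⟩ := hx
  exact congrArg (fun q : H →L[ℂ] H => q y) hp.isIdempotentElem.eq

theorem IsStarProjection.range_isOrtho {H : Type*} [NormedAddCommGroup H]
    [InnerProductSpace ℂ H] [CompleteSpace H] {p q : H →L[ℂ] H} (hp : IsStarProjection p)
    (h : p * q = 0) : p.range ⟂ q.range := by
  rw [Submodule.isOrtho_iff_inner_eq]
  rintro _ ⟨x, rfl⟩ _ ⟨y, rfl⟩
  change inner ℂ (p x) (q y) = 0
  rw [← ContinuousLinearMap.adjoint_inner_right, ← ContinuousLinearMap.star_eq_adjoint,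
    hp.isSelfAdjoint.star_eq]
  have h0 : p (q y) = 0 := congrArg (fun T : H →L[ℂ] H => T y) h
  rw [h0, inner_zero_right]

namespace Ultragraph

variable {V : Type*} {E : Type*} {G : Ultragraph V E}

/-! ### Paths and the removal process -/

variable (G) in
/-- `w` is a successor of `v` if some edge with source `v` has `w` in its range. -/
def IsSucc (w v : V) : Prop := ∃ e, G.s e = v ∧ w ∈ G.r e

namespace Sub

/-- An extreme set that is a range avoids all sources, and one that is a source avoids all ranges; a
vertex that is both a source and in a range lies in neither kind. -/
theorem notMem_sUnion_extremeVertices {K : G.Sub} {e f : E} (he : e ∈ K.edges)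
    (hf : f ∈ K.edges) (h : G.s f ∈ G.r e) : G.s f ∉ ⋃₀ K.extremeVertices := by
  rintro ⟨A, ⟨g, hg | hg⟩, hA⟩
  · exact Set.eq_empty_iff_forall_notMem.1 hg.2.2.2 _ ⟨hA, f, hf, rfl⟩
  · exact Set.eq_empty_iff_forall_notMem.1 hg.2.2.2 _ ⟨hA, Set.mem_biUnion he h⟩

/-- An edge with an edge before it and an edge after it is not extreme. -/
theorem notMem_extremeEdges {K : G.Sub} {d e f : E} (hd : d ∈ K.edges) (he : e ∈ K.edges)
    (hf : f ∈ K.edges) (hde : G.s e ∈ G.r d) (hef : G.s f ∈ G.r e) : e ∉ K.extremeEdges := by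
  rintro ⟨A, hg | hg⟩
  · have hA : G.s f ∈ A := hg.2.1 ▸ hef
    exact notMem_sUnion_extremeVertices he hf hef ⟨A, ⟨e, Or.inl hg⟩, hA⟩
  · have hA : G.s e ∈ A := hg.2.1 ▸ rfl
    exact notMem_sUnion_extremeVertices hd he hde ⟨A, ⟨e, Or.inr hg⟩, hA⟩

end Sub

/-- The `i`-th ultragraph of the removal process contains all edges of an infinite path but the
first `i` ones. -/
theorem path_mem_stage (e : ℕ → E) (he : ∀ j, G.s (e (j + 1)) ∈ G.r (e j)) (i : ℕ) :
    ∀ j, i ≤ j → e j ∈ (G.stage i).edges := by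
  induction i with
  | zero => exact fun j _ => Set.mem_univ _
  | succ i ih =>
    intro j hj
    -- Writing `j = k + 1` with `i ≤ k` gives `e j` a predecessor `e k` still present at stage `i`.
    -- The edge `e i` has no such guarantee, hence the loss of one edge per step.
    obtain ⟨k, rfl⟩ : ∃ k, j = k + 1 := ⟨j - 1, by omega⟩
    exact ⟨ih _ (by omega), Sub.notMem_extremeEdges (ih k (by omega)) (ih _ (by omega))
      (ih (k + 2) (by omega)) (he k) (he (k + 1))⟩

theorem stage_verts_antitone : Antitone fun i => (G.stage i).verts :=
  antitone_nat_of_succ_le fun _ _ hx => hx.1.1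

/-- The index matters: `X i` and `I i` are what is removed in passing from stage `i` to stage `i +
1`. -/
theorem notMem_stage_succ {i : ℕ} {x : V} (hx : x ∈ ⋃₀ G.X i ∪ G.I i) :
    x ∉ (G.stage (i + 1)).verts := by
  rintro ⟨⟨_, h1⟩, h2⟩
  exact hx.elim h1 h2

/-- If the removal process exhausts the ultragraph in finitely many steps, there is no infinite
path. -/
theorem wellFounded_isSucc {n : ℕ}
    (h : (⋃ e, G.r e) ∪ Set.range G.s ⊆ ⋃ i < n, (⋃₀ G.X i ∪ G.I i)) :
    WellFounded G.IsSucc := by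
  rw [wellFounded_iff_isEmpty_descending_chain]
  refine ⟨fun ⟨x, hx⟩ => ?_⟩
  choose e hs hr using hx
  have he : ∀ j, G.s (e (j + 1)) ∈ G.r (e j) := fun j => hs (j + 1) ▸ hr j
  have hmem := (G.stage n).s_mem _ (path_mem_stage e he n n le_rfl)
  -- The source of `e n` is still a vertex of stage `n`, yet the covering hypothesis says it was
  -- removed at a step `i < n`.
  obtain ⟨i, hi, hxi⟩ := Set.mem_iUnion₂.1 (h (Or.inr ⟨e n, rfl⟩))
  exact notMem_stage_succ hxi (stage_verts_antitone (Nat.succ_le_of_lt hi) hmem)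

/-! ### Representations -/

section Representation

variable {H : Type*} [NormedAddCommGroup H] [InnerProductSpace ℂ H] [CompleteSpace H]
  (π : G.CStar →⋆ₙₐ[ℂ] (H →L[ℂ] H))

theorem isStarProjection_map_P (A : G.GenVertex) : IsStarProjection (π (G.univFamily.P A)) :=
  (G.univFamily.isStarProjection A).map π

theorem isStarProjection_map_edge (e : E) :
    IsStarProjection (π (G.univFamily.S e * star (G.univFamily.S e))) := by
  refine IsStarProjection.map ⟨?_, ?_⟩ π
  · rw [IsIdempotentElem, ← mul_assoc, G.univFamily.partialIsometry]
  · exact IsSelfAdjoint.mul_star_self _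

theorem vertexSpace_isOrtho {v w : V} (h : v ≠ w) :
    vertexSpace π (G.vtx v) ⟂ vertexSpace π (G.vtx w) := by
  refine (isStarProjection_map_P π _).range_isOrtho ?_
  rw [← map_mul, G.univFamily.P_inter]
  have h0 : (⟨(G.vtx v).1 ∩ (G.vtx w).1, .inter (G.vtx v).2 (G.vtx w).2⟩ : G.GenVertex) =
      ⟨∅, .empty⟩ := Subtype.ext (Set.singleton_inter_eq_empty.2 h)
  rw [h0, G.univFamily.P_empty, map_zero]

theorem edgeSpace_isOrtho {e f : E} (h : e ≠ f) : edgeSpace π e ⟂ edgeSpace π f := by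
  refine (isStarProjection_map_edge π e).range_isOrtho ?_
  rw [← map_mul, G.univFamily.orthogonal e f h, map_zero]

theorem edgeSpace_le (e : E) : edgeSpace π e ≤ vertexSpace π (G.vtx (G.s e)) := by
  rintro _ ⟨x, rfl⟩
  refine ⟨π (G.univFamily.S e * star (G.univFamily.S e)) x, ?_⟩
  have h := congrArg (fun a => π a x) (G.univFamily.range_le e)
  simp only [map_mul π (G.univFamily.P _)] at h
  exact h

/-- Move `s_e` across the inner product: `s_e* s_e = p_{r(e)}` fixes `y`. -/
theorem inner_map_S (e : E) (x y : H) (hy : y ∈ vertexSpace π (G.rng e)) :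
    inner ℂ (π (G.univFamily.S e) x) (π (G.univFamily.S e) y) = inner ℂ x y := by
  rw [← ContinuousLinearMap.adjoint_inner_right, ← ContinuousLinearMap.star_eq_adjoint]
  have h : star (π (G.univFamily.S e)) * π (G.univFamily.S e) = π (G.univFamily.P (G.rng e)) := by
    rw [← map_star, ← map_mul, G.univFamily.star_mul]
  have h' := congrArg (fun T : H →L[ℂ] H => T y) h
  simp only [mul_apply_eq_comp] at h'
  rw [h', (isStarProjection_map_P π _).apply_of_mem_range hy]

/-- The two inclusions come from `s_e s_e* s_e = s_e` and from `s_e p_{r(e)} = s_e`. -/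
theorem map_S_vertexSpace (e : E) :
    (vertexSpace π (G.rng e)).map (π (G.univFamily.S e) : H →ₗ[ℂ] H) = edgeSpace π e := by
  have h : π (G.univFamily.S e) * π (G.univFamily.P (G.rng e)) = π (G.univFamily.S e) := by
    rw [← map_mul, ← G.univFamily.star_mul, ← mul_assoc, G.univFamily.partialIsometry]
  have h1 : π (G.univFamily.S e * star (G.univFamily.S e)) * π (G.univFamily.S e) =
      π (G.univFamily.S e) := by
    rw [← map_mul, G.univFamily.partialIsometry]
  have h2 : π (G.univFamily.S e * star (G.univFamily.S e)) =
      π (G.univFamily.S e) * π (star (G.univFamily.S e)) := map_mul _ _ _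
  apply le_antisymm
  · rintro _ ⟨x, -, rfl⟩
    exact ⟨π (G.univFamily.S e) x, congrArg (fun T : H →L[ℂ] H => T x) h1⟩
  · rintro _ ⟨x, rfl⟩
    refine ⟨π (G.univFamily.P (G.rng e)) (π (star (G.univFamily.S e)) x), ⟨_, rfl⟩, ?_⟩
    refine (congrArg (fun T : H →L[ℂ] H => T (π (star (G.univFamily.S e)) x)) h).trans ?_
    exact congrArg (fun T : H →L[ℂ] H => T x) h2.symm

theorem isONBasis_image_S {B : Set H} {e : E} (hB : IsONBasis B (vertexSpace π (G.rng e))) :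
    IsONBasis (π (G.univFamily.S e) '' B) (edgeSpace π e) :=
  hB.image _ (fun x _ y hy => inner_map_S π e x y hy) (map_S_vertexSpace π e)
    (isStarProjection_map_edge π e).isClosed_range

/-- If there are no infinite paths, the vertex spaces have orthonormal bases compatible with the
partial isometries of the edges. -/
theorem exists_compatible_bases (hwf : WellFounded G.IsSucc)
    (hsum : ∀ e, IsOrthogonalSum (vertexSpace π (G.rng e))
      (fun x : G.r e => vertexSpace π (G.vtx x))) :
    ∃ Bv : V → Set H, (∀ x, IsONBasis (Bv x) (vertexSpace π (G.vtx x))) ∧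
      ∀ e, π (G.univFamily.S e) '' (⋃ w : G.r e, Bv w) ⊆ Bv (G.s e) := by
  -- The recursion has to be defined before the prescribed vectors are known to be orthonormal, so
  -- `extendBasis` falls back on `∅` if no extension exists; `key` shows by induction that one
  -- always does.
  let F : ∀ v, (∀ w, G.IsSucc w v → Set H) → Set H := fun v IH =>
    extendBasis (vertexSpace π (G.vtx v)) (⋃ e : {e // G.s e = v},
      π (G.univFamily.S e) '' ⋃ w : G.r e, IH w ⟨e, e.2, w.2⟩)
  let Bv : V → Set H := hwf.fix F
  have hfix : ∀ v, Bv v = extendBasis (vertexSpace π (G.vtx v)) (⋃ e : {e // G.s e = v},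
      π (G.univFamily.S e) '' ⋃ w : G.r e, Bv w) := fun v => hwf.fix_eq F v
  have key : ∀ v, (⋃ e : {e // G.s e = v}, π (G.univFamily.S e) '' ⋃ w : G.r e, Bv w) ⊆ Bv v ∧
      IsONBasis (Bv v) (vertexSpace π (G.vtx v)) := by
    intro v
    induction v using hwf.induction with
    | _ v ih =>
      have hBe : ∀ e : {e // G.s e = v},
          IsONBasis (π (G.univFamily.S e) '' ⋃ w : G.r e, Bv w) (edgeSpace π e.1) := fun e =>
        isONBasis_image_S π ((hsum e).isONBasis_iUnion fun w => (ih w ⟨e, e.2, w.2⟩).2)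
      have hc : CompleteSpace (vertexSpace π (G.vtx v)) :=
        (isStarProjection_map_P π (G.vtx v)).isClosed_range.completeSpace_coe
      -- Distinct edges have orthogonal range spaces, all inside `H_v` when their source is `v`, so
      -- the prescribed vectors form an orthonormal subset of `H_v`.
      have hext := extendBasis_spec (exists_isONBasis_extension (K := vertexSpace π (G.vtx v))
        (orthonormal_iUnion (fun e => (hBe e).1) (fun e => (hBe e).subset)
          fun e f hef => edgeSpace_isOrtho π (Subtype.coe_injective.ne hef))
        (Set.iUnion_subset fun e => (hBe e).subset.trans (by
          have h := edgeSpace_le π e.1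
          rwa [e.2] at h)))
      rwa [← hfix] at hext
  exact ⟨Bv, fun v => (key v).2, fun e =>
    (Set.subset_iUnion (fun f : {f // G.s f = G.s e} =>
      π (G.univFamily.S f) '' ⋃ w : G.r f, Bv w) ⟨e, rfl⟩).trans (key (G.s e)).1⟩

end Representation

end Ultragraph

/-! ### Assembling the bases. -/

theorem mainTheorem6 {V E : Type*} [Countable V] [Countable E] (G : Ultragraph V E)
    {H : Type*} [NormedAddCommGroup H] [InnerProductSpace ℂ H] [CompleteSpace H]
    (π : G.CStar →⋆ₙₐ[ℂ] (H →L[ℂ] H))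
    (hsum : ∀ e, IsOrthogonalSum (Ultragraph.vertexSpace π (G.rng e))
      (fun x : G.r e => Ultragraph.vertexSpace π (G.vtx x)))
    (hremove : ∃ n : ℕ, 1 ≤ n ∧ (∀ i < n, (G.X i).Nonempty) ∧
      (⋃ e, G.r e) ∪ Set.range G.s = ⋃ i < n, (⋃₀ G.X i ∪ G.I i)) :
    Ultragraph.IsPermutative π := by
  obtain ⟨n, -, -, hn⟩ := hremove
  obtain ⟨Bv, hBv, hcomp⟩ := Ultragraph.exists_compatible_bases π
    (Ultragraph.wellFounded_isSucc hn.subset) hsum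
  have : CompleteSpace (⊤ : Submodule ℂ H) := isClosed_univ.completeSpace_coe
  -- As `π` may be degenerate, the spaces `H_v` need not span `H`; the union of the `Bv v` is
  -- completed by arbitrary vectors.
  obtain ⟨B, hvB, hB⟩ := exists_isONBasis_extension (K := (⊤ : Submodule ℂ H))
    (orthonormal_iUnion (fun v => (hBv v).1) (fun v => (hBv v).subset)
      fun v w h => Ultragraph.vertexSpace_isOrtho π h) (Set.subset_univ _)
  have hBr := fun e => (hsum e).isONBasis_iUnion fun w => hBv w
  refine ⟨B, Bv, fun e => ⋃ w : G.r e, Bv w,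
    fun e => π (G.univFamily.S e) '' ⋃ w : G.r e, Bv w, hB, hBv, hBr,
    fun e => Ultragraph.isONBasis_image_S π (hBr e),
    ⟨fun e => (Set.iUnion_subset fun w : G.r e => Set.subset_iUnion Bv w.1).trans hvB,
      fun v => (Set.subset_iUnion Bv v).trans hvB⟩,
    fun x e hx => Set.subset_iUnion (fun w : G.r e => Bv w) ⟨x, hx⟩, fun x => ?_, fun _ => rfl⟩
  refine Set.iUnion₂_subset fun e he => ?_
  rw [← show G.s e = x from he]
  exact hcomp e
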